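/- **Setting.** Let $(X,d)$ be a nonempty metric space. * $X$ is *hyperbolic* if there is $\delta\ge 0$ such that for all $x_1,x_2,x_3,x_4\in X$, $$d(x_1,x_4)+d(x_2,x_3)\le \max\bigl(d(x_1,x_2)+d(x_3,x_4),\ d(x_1,x_3)+d(x_2,x_4)\bigr)+\delta .$$ * $X$ is *weakly geodesic* if there is $\delta\ge 0$ such that for all $x,y\in X$ and all real $s\in[0,d(x,y)+\delta]$ there is $z\in X$ with $d(x,z)\le s$ and $d(z,y)\le d(x,y)-s+\delta$. * $X$ is *uniformly locally finite* if for every $r\ge 0$ there is an integer $K$ such that every closed ball of radius $r$ in $X$ contains at most $K$ points. * For $R\in\mathbb N$, $X^{\le R}=\{(x,y)\in X\times X : d(x,y)\le R\}$. Let $G$ be a topological group (for instance a discrete group); "$g\to\infty$" means that $g$ leaves every compact subset of $G$. A continuous isometric action of $G$ on $X$ is *proper* if $d(o,g\cdot o)\to\infty$ as $g\to\infty$, for every $o\in X$. An *affine isometric action* of $G$ on a real Banach space $E$ is a homomorphism $\alpha$ from $G$ to the group of affine isometries of $E$ such that $g\mapsto\alpha(g)\xi$ is continuous for every $\xi\in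 E$; it is *proper* if its cocycle $c(g)=\alpha(g)o-o$ satisfies $\|c(g)\|\to\infty$ as $g\to\infty$, for every choice of origin $o\in E$. **Theorem.** Let $(X,d)$ be a nonempty hyperbolic, weakly geodesic, uniformly locally finite metric space with a proper continuous isometric action of a topological group $G$. Then there exist an integer $R\in\mathbb N$ and a real $p_0$ such that for every real $p\ge 1$ with $p\ge p_0$, the group $G$ admits a proper affine isometric action on the real Banach space $\ell^p(X^{\le R})$. -/

import Mathlib

open Filter
open scoped ENNReal NNReal

/-- A metric space is hyperbolic if it satisfies the four-point inequality
for some constant `δ ≥ 0`. -/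
def IsHyperbolicSpace (X : Type*) [MetricSpace X] : Prop :=
  ∃ δ : ℝ, 0 ≤ δ ∧ ∀ x₁ x₂ x₃ x₄ : X,
    dist x₁ x₄ + dist x₂ x₃ ≤
      max (dist x₁ x₂ + dist x₃ x₄) (dist x₁ x₃ + dist x₂ x₄) + δ

/-- A metric space is weakly geodesic if it is weakly `δ`-geodesic for some `δ ≥ 0`. -/
def IsWeaklyGeodesic (X : Type*) [MetricSpace X] : Prop :=
  ∃ δ : ℝ, 0 ≤ δ ∧ ∀ x y : X, ∀ s ∈ Set.Icc (0 : ℝ) (dist x y + δ),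
    ∃ z : X, dist x z ≤ s ∧ dist z y ≤ dist x y - s + δ

/-- A metric space is uniformly locally finite if, for each `r ≥ 0`, the cardinality of the
closed balls of radius `r` is uniformly bounded. -/
def IsUniformlyLocallyFinite (X : Type*) [MetricSpace X] : Prop :=
  ∀ r : ℝ, 0 ≤ r → ∃ K : ℕ, ∀ x : X, (Metric.closedBall x r).encard ≤ K

/-- The set `X^{≤ R}` of pairs of points of `X` at distance at most `R`. -/
def pairsWithin (X : Type*) [MetricSpace X] (R : ℕ) : Set (X × X) :=
  {q | dist q.1 q.2 ≤ (R : ℝ)}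

/-- An action on a metric space is (metrically) proper if `d(o, g • o) → ∞` as `g → ∞`, i.e.
as `g` leaves the compact subsets of `G`. -/
def IsMetricallyProperAction (G X : Type*) [Group G] [TopologicalSpace G] [MetricSpace X]
    [MulAction G X] : Prop :=
  ∀ o : X, Tendsto (fun g : G => dist o (g • o)) (cocompact G) atTop

/-- An affine isometric action of a topological group `G` on an affine space `P` over the normed
space `E`: a homomorphism from `G` to the group of affine isometries of `P`, all of whose orbit
maps are continuous. -/
structure AffineIsometricAction (G E P : Type*) [Group G] [TopologicalSpace G]
    [NormedAddCommGroup E] [NormedSpace ℝ E] [MetricSpace P] [NormedAddTorsor E P] where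
  toHom : G →* (P ≃ᵃⁱ[ℝ] P)
  continuous_orbit : ∀ ξ : P, Continuous fun g : G => toHom g ξ

namespace AffineIsometricAction

variable {G E P : Type*} [Group G] [TopologicalSpace G]
  [NormedAddCommGroup E] [NormedSpace ℝ E] [MetricSpace P] [NormedAddTorsor E P]

/-- The cocycle of an affine isometric action with respect to the origin `o`; it is the map `c`
such that `α g ξ = π g (ξ - o) + c g + o`, where `π` is the linear part of `α`. -/
noncomputable def cocycle (α : AffineIsometricAction G E P) (o : P) (g : G) : E :=
  α.toHom g o -ᵥ o

/-- An affine isometric action is proper if its cocycle satisfies `‖c g‖ → ∞` as `g → ∞`. -/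
def IsProper (α : AffineIsometricAction G E P) : Prop :=
  ∀ o : P, Tendsto (fun g : G => ‖α.cocycle o g‖) (cocompact G) atTop

end AffineIsometricAction

/-! Fix a large scale N and a target a. From x, descend towards a at random: at each level kN, ...,
2N, N jump to a uniformly chosen point at that level near a geodesic to a. The weight of (a, b) seen
from x is the probability of ending at b, which lies in the N-ball about a. This gives an
equivariant map f from X to functions on pairs, and g ↦ f(g • o) - f(o) is the cocycle.

Differences lie in ℓ^p: descents from x and y come within a bounded distance of each other, and then
each level offers two overlapping choices among at most K points. The influence of the start thus
shrinks by a factor l = 1 - 1/K² per level (`abs_visualWeight_sub_le`). Balls grow at most like K^n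
(`card_le_pow`), so the p-th powers are summable once K l^p < 1.

The cocycle is proper: for a near a geodesic from x to y, the two descents end on opposite sides of
a, so some weight is at least 1/K from x and zero from y. Geodesics supply linearly many such a
(`le_norm_rpow`). -/

/-- The average of a real function over a set (`0` if the set is empty). -/
noncomputable def setMean {X : Type*} (s : Set X) (φ : X → ℝ) : ℝ :=
  (∑ᶠ w ∈ s, φ w) / s.ncard

/-! ### Averages over finite sets. -/

theorem setMean_eq {X : Type*} {s : Set X} (hs : s.Finite) (φ : X → ℝ) :
    setMean s φ = (∑ w ∈ hs.toFinset, φ w) / hs.toFinset.card := by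
  rw [setMean, finsum_mem_eq_finite_toFinset_sum _ hs, Set.ncard_eq_toFinset_card _ hs]

theorem setMean_mem_Icc {X : Type*} {s : Set X} (hs : s.Finite) {φ : X → ℝ}
    (h : ∀ w, φ w ∈ Set.Icc (0 : ℝ) 1) : setMean s φ ∈ Set.Icc (0 : ℝ) 1 := by
  rw [setMean_eq hs]
  refine ⟨div_nonneg (Finset.sum_nonneg fun w _ => (h w).1) (by positivity),
    div_le_one_of_le₀ ?_ (by positivity)⟩
  calc ∑ w ∈ hs.toFinset, φ w ≤ ∑ w ∈ hs.toFinset, (1 : ℝ) :=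
        Finset.sum_le_sum fun w _ => (h w).2
    _ = _ := by simp

theorem abs_setMean_sub_le {X : Type*} {s : Set X} (hs : s.Finite) (hne : s.Nonempty)
    {φ : X → ℝ} {c ε : ℝ} (h : ∀ w ∈ s, |φ w - c| ≤ ε) : |setMean s φ - c| ≤ ε := by
  have hpos : (0 : ℝ) < hs.toFinset.card := by
    exact_mod_cast Finset.card_pos.2 (hs.toFinset_nonempty.2 hne)
  have : setMean s φ - c = (∑ w ∈ hs.toFinset, (φ w - c)) / hs.toFinset.card := by
    rw [setMean_eq hs, Finset.sum_sub_distrib, Finset.sum_const, nsmul_eq_mul]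
    field_simp
  rw [this, abs_div, abs_of_pos hpos, div_le_iff₀ hpos]
  calc |∑ w ∈ hs.toFinset, (φ w - c)| ≤ ∑ w ∈ hs.toFinset, |φ w - c| :=
        Finset.abs_sum_le_sum_abs _ _
    _ ≤ ∑ w ∈ hs.toFinset, ε := Finset.sum_le_sum fun w hw => h w (hs.mem_toFinset.1 hw)
    _ = _ := by simp [mul_comm]

/-- Averages over two intersecting finite sets differ by strictly less than the oscillation. -/
theorem abs_setMean_sub_setMean_le {X : Type*} {s t : Set X} (hs : s.Finite) (ht : t.Finite)
    {c : X} (hcs : c ∈ s) (hct : c ∈ t) {K : ℕ} (hK : s.ncard * t.ncard ≤ K)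
    {φ : X → ℝ} {ε : ℝ} (hε : 0 ≤ ε) (h : ∀ u ∈ s, ∀ v ∈ t, |φ u - φ v| ≤ ε) :
    |setMean s φ - setMean t φ| ≤ (1 - 1 / (K : ℝ)) * ε := by
  classical
  rw [Set.ncard_eq_toFinset_card _ hs, Set.ncard_eq_toFinset_card _ ht] at hK
  rw [setMean_eq hs, setMean_eq ht]
  set S := hs.toFinset
  set T := ht.toFinset
  have hS : c ∈ S := hs.mem_toFinset.2 hcs
  have hT : c ∈ T := ht.mem_toFinset.2 hct
  have hSpos : (0 : ℝ) < S.card := by exact_mod_cast Finset.card_pos.2 ⟨c, hS⟩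
  have hTpos : (0 : ℝ) < T.card := by exact_mod_cast Finset.card_pos.2 ⟨c, hT⟩
  have hKr : (S.card : ℝ) * T.card ≤ K := by exact_mod_cast hK
  have hprod : (0 : ℝ) < S.card * T.card := mul_pos hSpos hTpos
  -- The difference is an average over independent pairs (u, v).
  have heq : (∑ w ∈ S, φ w) / S.card - (∑ w ∈ T, φ w) / T.card =
      (∑ q ∈ S ×ˢ T, (φ q.1 - φ q.2)) / (S.card * T.card) := by
    rw [Finset.sum_product]
    simp only [Finset.sum_sub_distrib, Finset.sum_const, nsmul_eq_mul, ← Finset.mul_sum]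
    field_simp
  have hle : |∑ q ∈ S ×ˢ T, (φ q.1 - φ q.2)| ≤ ((S.card : ℝ) * T.card - 1) * ε := by
    have hmem : (c, c) ∈ S ×ˢ T := Finset.mk_mem_product hS hT
    -- The pair (c, c) contributes zero; this is the whole gain.
    rw [← Finset.sum_erase (a := (c, c)) _ (by simp)]
    refine (Finset.abs_sum_le_sum_abs _ _).trans ?_
    refine (Finset.sum_le_card_nsmul _ _ ε ?_).trans ?_
    · intro q hq
      have hq' := Finset.mem_product.1 (Finset.mem_of_mem_erase hq)
      exact h _ (hs.mem_toFinset.1 hq'.1) _ (ht.mem_toFinset.1 hq'.2)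
    · rw [Finset.card_erase_of_mem hmem, nsmul_eq_mul, Finset.card_product,
        Nat.cast_sub (Nat.mul_pos (Finset.card_pos.2 ⟨c, hS⟩) (Finset.card_pos.2 ⟨c, hT⟩))]
      push_cast
      exact le_rfl
  rw [heq, abs_div, abs_of_pos hprod, div_le_iff₀ hprod]
  refine hle.trans ?_
  have : 1 / (K : ℝ) * (S.card * T.card) ≤ 1 := by
    rw [one_div, inv_mul_le_iff₀ (hprod.trans_le hKr)]
    simpa using hKr
  nlinarith

theorem setMean_image {X Y : Type*} {g : X → Y} (hg : g.Injective) (s : Set X) (φ : Y → ℝ) :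
    setMean (g '' s) φ = setMean s (φ ∘ g) := by
  rw [setMean, setMean, finsum_mem_image hg.injOn, Set.ncard_image_of_injective _ hg]
  rfl

theorem setMean_sum {X ι : Type*} {s : Set X} (hs : s.Finite) (T : Finset ι)
    (φ : ι → X → ℝ) :
    setMean s (fun w => ∑ i ∈ T, φ i w) = ∑ i ∈ T, setMean s (φ i) := by
  simp only [setMean_eq hs]
  rw [Finset.sum_comm, Finset.sum_div]

/-! ### Shadows and the random descent. -/

/-- Hyperbolicity and weak geodesicity with a common constant `e`, finiteness of balls, and a
scale `N` large compared with `e`. -/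
structure HyperbolicScale (X : Type*) [MetricSpace X] (e : ℝ) (N : ℕ) : Prop where
  nonneg : 0 ≤ e
  four_point : ∀ x₁ x₂ x₃ x₄ : X,
    dist x₁ x₄ + dist x₂ x₃ ≤
      max (dist x₁ x₂ + dist x₃ x₄) (dist x₁ x₃ + dist x₂ x₄) + e
  geodesic : ∀ (x y : X) (s : ℝ), 0 ≤ s → s ≤ dist x y →
    ∃ z : X, dist x z ≤ s ∧ dist z y ≤ dist x y - s + e
  le_scale : 6 * e + 1 ≤ N
  finite_ball : ∀ (x : X) (r : ℝ), (Metric.closedBall x r).Finite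

/-- The points of the `s`-ball about `a` lying, up to `η`, on a geodesic from `a` to `z`. -/
def shadow {X : Type*} [MetricSpace X] (η : ℝ) (a z : X) (s : ℝ) : Set X :=
  {w | dist a w ≤ s ∧ dist w z ≤ dist a z - s + η}

/-- Iterated averages of `φ` over the shadows at the levels `N`, `2 N`, ... around `a`. -/
noncomputable def shadowFlow {X : Type*} [MetricSpace X] (e : ℝ) (N : ℕ) (φ : X → ℝ) (a : X) :
    ℕ → X → ℝ
  | 0 => φ
  | j + 1 => fun z => setMean (shadow (2 * e) a z ((j + 1 : ℝ) * N)) (shadowFlow e N φ a j)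

/-- The weight at `q.2` of the random descent from `x` towards `q.1`. -/
noncomputable def visualWeight {X : Type*} [MetricSpace X] (e : ℝ) (N : ℕ) (x : X) (q : X × X) :
    ℝ :=
  shadowFlow e N (Set.indicator {q.2} 1) q.1 ⌊dist q.1 x / N⌋₊ x

theorem indicator_singleton_mem_Icc {X : Type*} (b w : X) :
    Set.indicator {b} (1 : X → ℝ) w ∈ Set.Icc (0 : ℝ) 1 := by
  by_cases hw : w ∈ ({b} : Set X)
  · simp [Set.indicator_of_mem hw]
  · simp [Set.indicator_of_notMem hw]

namespace HyperbolicScale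

variable {X : Type*} [MetricSpace X] {e : ℝ} {N : ℕ}

theorem scale_pos (h : HyperbolicScale X e N) : (0 : ℝ) < N := by
  linarith [h.nonneg, h.le_scale]

theorem finite_shadow (h : HyperbolicScale X e N) (η : ℝ) (a z : X) (s : ℝ) :
    (shadow η a z s).Finite :=
  (h.finite_ball a s).subset fun w hw => by simpa [dist_comm] using hw.1

theorem shadow_mono {η η' : ℝ} (hη : η ≤ η') (a z : X) (s : ℝ) :
    shadow η a z s ⊆ shadow η' a z s :=
  fun _ hw => ⟨hw.1, hw.2.trans (by linarith)⟩

theorem shadow_nonempty (h : HyperbolicScale X e N) {a z : X} {s : ℝ} (hs : 0 ≤ s)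
    (hsz : s ≤ dist a z) : (shadow e a z s).Nonempty :=
  h.geodesic a z s hs hsz

theorem le_dist_of_mem_shadow {η : ℝ} {a z w : X} {s : ℝ} (hw : w ∈ shadow η a z s) :
    s - η ≤ dist a w := by
  linarith [hw.2, dist_triangle a w z]

/-- The hypothesis `hz` bounds the Gromov product of z and z' at a below by s - η/2: the geodesics
from a have not yet separated at level s. The four-point inequality then costs only e. -/
theorem mem_shadow_of_mem_shadow (h : HyperbolicScale X e N) {η : ℝ} {a z z' w : X} {s : ℝ}
    (hw : w ∈ shadow η a z s) (hz : 2 * s + dist z z' ≤ dist a z + dist a z' + η) :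
    w ∈ shadow (η + e) a z' s := by
  refine ⟨hw.1, ?_⟩
  have h4 := h.four_point w a z z'
  rcases max_cases (dist w a + dist z z') (dist w z + dist a z') with hm | hm <;>
    rw [hm.1] at h4 <;> linarith [hw.1, hw.2, dist_comm a w]

/-- Geodesics are thin: the bound does not depend on s. -/
theorem dist_le_of_mem_shadow (h : HyperbolicScale X e N) {η : ℝ} {a z w w' : X} {s : ℝ}
    (hw : w ∈ shadow η a z s) (hw' : w' ∈ shadow η a z s) : dist w w' ≤ η + e := by
  have h4 := h.four_point w a z w'
  rcases max_cases (dist w a + dist z w') (dist w z + dist a w') with hm | hm <;>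
    rw [hm.1] at h4 <;>
    linarith [hw.1, hw.2, hw'.1, hw'.2, dist_comm a w, dist_comm z w']

/-- Errors do not accumulate along the descent: a drop of N levels absorbs the old slack, and the
new one is 2e + e again. -/
theorem mem_shadow_of_step (h : HyperbolicScale X e N) {a x z w : X} {s : ℝ}
    (hz : z ∈ shadow (3 * e) a x (s + N)) (hw : w ∈ shadow (2 * e) a z s) :
    w ∈ shadow (3 * e) a x s := by
  have := h.mem_shadow_of_mem_shadow (z' := x) hw (by
    linarith [hz.2, le_dist_of_mem_shadow hz, h.le_scale, h.nonneg])
  exact shadow_mono (by linarith) _ _ _ this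

theorem shadowFlow_mem_Icc (h : HyperbolicScale X e N) {φ : X → ℝ}
    (hφ : ∀ w, φ w ∈ Set.Icc (0 : ℝ) 1) (a : X) (j : ℕ) (x : X) :
    shadowFlow e N φ a j x ∈ Set.Icc (0 : ℝ) 1 := by
  induction j generalizing x with
  | zero => exact hφ x
  | succ j ih => exact setMean_mem_Icc (h.finite_shadow _ _ _ _) ih

theorem shadowFlow_sum (h : HyperbolicScale X e N) {ι : Type*} (T : Finset ι)
    (φ : ι → X → ℝ) (a : X) (j : ℕ) (x : X) :
    shadowFlow e N (fun w => ∑ i ∈ T, φ i w) a j x = ∑ i ∈ T, shadowFlow e N (φ i) a j x := by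
  induction j generalizing x with
  | zero => rfl
  | succ j ih =>
    simp only [shadowFlow]
    rw [← setMean_sum (h.finite_shadow _ _ _ _)]
    congr 1
    exact funext ih

/-- A bound for the flow on a shadow of `x` propagates to `x`. -/
theorem abs_shadowFlow_sub_le (h : HyperbolicScale X e N) {φ : X → ℝ} {a x : X} {j k : ℕ}
    (hjk : j < k) (hk : (k : ℝ) * N ≤ dist a x) {c ε : ℝ}
    (hc : ∀ w ∈ shadow (3 * e) a x ((j + 1 : ℝ) * N), |shadowFlow e N φ a j w - c| ≤ ε) :
    |shadowFlow e N φ a k x - c| ≤ ε := by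
  have hN := h.scale_pos
  have he := h.nonneg
  -- The descent stays in the 3e-shadows of x, and averaging preserves the bound.
  have key : ∀ i, j ≤ i → i < k → ∀ w ∈ shadow (3 * e) a x ((i + 1 : ℝ) * N),
      |shadowFlow e N φ a i w - c| ≤ ε := by
    intro i hji
    induction i, hji using Nat.le_induction with
    | base => exact fun _ => hc
    | succ i hji ih =>
      intro hik w hw
      have hlow := le_dist_of_mem_shadow hw
      push_cast at hw hlow
      refine abs_setMean_sub_le (h.finite_shadow _ _ _ _) ?_ ?_
      · refine (h.shadow_nonempty (by positivity) ?_).mono (shadow_mono (by linarith) _ _ _)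
        nlinarith [h.le_scale]
      · intro w' hw'
        refine ih (by omega) w' (h.mem_shadow_of_step (z := w) ?_ hw')
        rwa [show (i + 1 : ℝ) * N + N = (i + 1 + 1 : ℝ) * N by ring]
  obtain ⟨i, rfl⟩ : ∃ i, k = i + 1 := ⟨k - 1, by omega⟩
  push_cast at hk
  refine abs_setMean_sub_le (h.finite_shadow _ _ _ _) ?_ ?_
  · exact (h.shadow_nonempty (by positivity) hk).mono (shadow_mono (by linarith) _ _ _)
  · exact fun w hw => key i (by omega) (by omega) w (shadow_mono (by linarith) _ _ _ hw)

/-- Coupling argument: nearby points have intersecting shadows of size at most K, so each level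
gains a factor l, and points of the two shadows are again within 5e. -/
theorem abs_shadowFlow_sub_shadowFlow_le (h : HyperbolicScale X e N) {φ : X → ℝ}
    (hφ : ∀ w, φ w ∈ Set.Icc (0 : ℝ) 1) {K : ℕ}
    (hK : ∀ x : X, (Metric.closedBall x (5 * e)).ncard ≤ K) {l : ℝ} (hl : 0 ≤ l)
    (hKl : 1 - 1 / ((K * K : ℕ) : ℝ) ≤ l) (a : X) (j : ℕ) {z z' : X}
    (hz : (j + 1 : ℝ) * N - 3 * e ≤ dist a z) (hz' : (j + 1 : ℝ) * N - 3 * e ≤ dist a z')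
    (hzz : dist z z' ≤ 5 * e) :
    |shadowFlow e N φ a j z - shadowFlow e N φ a j z'| ≤ l ^ j := by
  have hN := h.scale_pos
  have he := h.nonneg
  have hNe := h.le_scale
  induction j generalizing z z' with
  | zero =>
    have h1 := hφ z
    have h2 := hφ z'
    simp only [shadowFlow, pow_zero]
    exact abs_sub_le_iff.2 ⟨by linarith [h1.2, h2.1], by linarith [h1.1, h2.2]⟩
  | succ j ih =>
    push_cast at hz hz'
    set s : ℝ := (j + 1 : ℝ) * N with hs
    have hs0 : 0 ≤ s := by positivity
    have hz1 : s + N - 3 * e ≤ dist a z := by rw [hs]; linarith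
    have hz1' : s + N - 3 * e ≤ dist a z' := by rw [hs]; linarith
    -- Weak geodesicity provides c with slack e, and passing from z to z' costs another e; hence the
    -- slack 2e in the flow.
    obtain ⟨c, hc⟩ := h.shadow_nonempty (a := a) (z := z) hs0 (by linarith)
    have hcz : c ∈ shadow (2 * e) a z s := shadow_mono (by linarith) _ _ _ hc
    have hcz' : c ∈ shadow (2 * e) a z' s :=
      shadow_mono (by linarith) _ _ _ (h.mem_shadow_of_mem_shadow (z' := z') hc (by linarith))
    have hcard : ∀ y : X, c ∈ shadow (2 * e) a y s → (shadow (2 * e) a y s).ncard ≤ K := by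
      intro y hy
      refine (Set.ncard_le_ncard ?_ (h.finite_ball c (5 * e))).trans (hK c)
      intro w hw
      exact Metric.mem_closedBall.2 ((h.dist_le_of_mem_shadow hw hy).trans (by linarith))
    have := abs_setMean_sub_setMean_le (h.finite_shadow (2 * e) a z s)
      (h.finite_shadow (2 * e) a z' s) hcz hcz' (Nat.mul_le_mul (hcard z hcz) (hcard z' hcz'))
      (φ := shadowFlow e N φ a j) (pow_nonneg hl j) ?_
    · refine this.trans ?_
      rw [pow_succ']
      exact mul_le_mul_of_nonneg_right hKl (pow_nonneg hl j)
    · intro u hu v hv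
      have hu' := h.mem_shadow_of_mem_shadow (z' := z') hu (by linarith)
      have hd := h.dist_le_of_mem_shadow hu' (shadow_mono (by linarith) _ _ _ hv)
      exact ih (by linarith [le_dist_of_mem_shadow hu]) (by linarith [le_dist_of_mem_shadow hv])
        (by linarith)

/-! ### Decay, support and total mass of the weights. -/

theorem visualWeight_mem_Icc (h : HyperbolicScale X e N) (x : X) (q : X × X) :
    visualWeight e N x q ∈ Set.Icc (0 : ℝ) 1 :=
  h.shadowFlow_mem_Icc (indicator_singleton_mem_Icc _) _ _ _

theorem floor_mul_le (h : HyperbolicScale X e N) (a x : X) :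
    (⌊dist a x / N⌋₊ : ℝ) * N ≤ dist a x := by
  rw [← le_div_iff₀ h.scale_pos]
  exact Nat.floor_le (by have := h.scale_pos; positivity)

theorem le_floor (h : HyperbolicScale X e N) {a x : X} {k : ℕ} (hk : (k : ℝ) * N ≤ dist a x) :
    k ≤ ⌊dist a x / N⌋₊ :=
  Nat.le_floor ((le_div_iff₀ h.scale_pos).2 hk)

/-- The dependence of the weights on the base point decays exponentially. -/
theorem abs_visualWeight_sub_le (h : HyperbolicScale X e N) {K : ℕ}
    (hK : ∀ x : X, (Metric.closedBall x (5 * e)).ncard ≤ K) {l : ℝ} (hl : 0 ≤ l)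
    (hKl : 1 - 1 / ((K * K : ℕ) : ℝ) ≤ l) {x y : X} {m : ℕ} (hm : dist x y ≤ m * N)
    (q : X × X) :
    |visualWeight e N x q - visualWeight e N y q| ≤ l ^ (⌊dist q.1 x / N⌋₊ - (m + 1)) := by
  have hN := h.scale_pos
  have he := h.nonneg
  set n := ⌊dist q.1 x / N⌋₊ with hn
  rcases le_or_gt n m with hnm | hnm
  · rw [Nat.sub_eq_zero_of_le (by omega), pow_zero]
    have h1 := h.visualWeight_mem_Icc x q
    have h2 := h.visualWeight_mem_Icc y q
    exact abs_sub_le_iff.2 ⟨by linarith [h1.2, h2.1], by linarith [h1.1, h2.2]⟩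
  -- Both x and y lie beyond level (n - m)N = (j + 1)N, so both descents reach it, with j
  -- contracting levels left.
  obtain ⟨j, hj⟩ : ∃ j, n = j + (m + 1) := ⟨n - (m + 1), by omega⟩
  have hx := h.floor_mul_le q.1 x
  rw [← hn, hj] at hx
  push_cast at hx
  have htri := dist_triangle q.1 y x
  rw [dist_comm y x] at htri
  have hjx : (j + 1 : ℝ) * N ≤ dist q.1 x := by nlinarith [dist_nonneg (x := x) (y := y)]
  have hjy : (j + 1 : ℝ) * N ≤ dist q.1 y := by nlinarith
  have hkx : j < n := by omega
  have hky : j < ⌊dist q.1 y / N⌋₊ := h.le_floor (by push_cast; exact hjy)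
  rw [hj, Nat.add_sub_cancel]
  refine h.abs_shadowFlow_sub_le hkx (h.floor_mul_le _ _) fun w hw => ?_
  rw [abs_sub_comm]
  refine h.abs_shadowFlow_sub_le hky (h.floor_mul_le _ _) fun w' hw' => ?_
  refine h.abs_shadowFlow_sub_shadowFlow_le (indicator_singleton_mem_Icc _) hK hl hKl _ _
    (le_dist_of_mem_shadow hw') (le_dist_of_mem_shadow hw) ?_
  -- Passing from x to y raises the slack to 4e, so the points are within 5e; this fixes the radius
  -- 5e.
  have hw2 := h.mem_shadow_of_mem_shadow (z' := y) hw (by nlinarith)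
  exact (h.dist_le_of_mem_shadow (shadow_mono (by linarith) _ _ _ hw') hw2).trans (by linarith)

/-- The last jump lands in the 3e-shadow of x at level N: propagation from j = 0 with zero error. -/
theorem visualWeight_eq_zero (h : HyperbolicScale X e N) {x : X} {q : X × X}
    (hx : N ≤ dist q.1 x) (hq : q.2 ∉ shadow (3 * e) q.1 x N) : visualWeight e N x q = 0 := by
  have hk : 0 < ⌊dist q.1 x / N⌋₊ := h.le_floor (by simpa using hx)
  have := h.abs_shadowFlow_sub_le (φ := Set.indicator {q.2} 1) (c := 0) (ε := 0) hk
    (h.floor_mul_le q.1 x) (fun w hw => by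
      have hw2 : w ∉ ({q.2} : Set X) := by
        rintro rfl
        simp at hw
        exact hq hw
      simp [shadowFlow, Set.indicator_of_notMem hw2])
  exact sub_eq_zero.1 (abs_eq_zero.1 (le_antisymm this (abs_nonneg _)))

theorem sum_visualWeight (h : HyperbolicScale X e N) {a x : X} (hx : N ≤ dist a x) :
    ∑ b ∈ (h.finite_ball a N).toFinset, visualWeight e N x (a, b) = 1 := by
  have hk : 0 < ⌊dist a x / N⌋₊ := h.le_floor (by simpa using hx)
  have := h.abs_shadowFlow_sub_le
    (φ := fun w => ∑ b ∈ (h.finite_ball a N).toFinset, Set.indicator {b} 1 w)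
    (c := 1) (ε := 0) hk (h.floor_mul_le a x) (fun w hw => by
      have hw1 : w ∈ (h.finite_ball a N).toFinset := by
        simpa [dist_comm] using hw.1
      have : ∑ b ∈ (h.finite_ball a N).toFinset, Set.indicator {b} (1 : X → ℝ) w = 1 := by
        rw [Finset.sum_eq_single_of_mem w hw1]
        · simp
        · intro b _ hb
          exact Set.indicator_of_notMem (fun hwb => hb (Set.mem_singleton_iff.1 hwb).symm) _
      simp [shadowFlow, this])
  rw [h.shadowFlow_sum] at this
  exact sub_eq_zero.1 (abs_eq_zero.1 (le_antisymm this (abs_nonneg _)))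

/-- Near a geodesic from `x` to `y`, some weight distinguishes `x` from `y`. -/
theorem exists_le_abs_visualWeight_sub (h : HyperbolicScale X e N) {K : ℕ}
    (hK : ∀ x : X, (Metric.closedBall x N).ncard ≤ K) {a x y : X} (hx : N ≤ dist a x)
    (hy : N ≤ dist a y) (hxy : dist a x + dist a y ≤ dist x y + e) :
    ∃ b, dist a b ≤ N ∧
      1 / (K : ℝ) ≤ |visualWeight e N x (a, b) - visualWeight e N y (a, b)| := by
  have he := h.nonneg
  have hNe := h.le_scale
  have hN := h.scale_pos
  have ha : a ∈ (h.finite_ball a N).toFinset := by simp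
  have hcard : ((h.finite_ball a N).toFinset.card : ℝ) ≤ K := by
    rw [← Set.ncard_eq_toFinset_card _ (h.finite_ball a N)]
    exact_mod_cast hK a
  have hcpos : (0 : ℝ) < (h.finite_ball a N).toFinset.card := by
    exact_mod_cast Finset.card_pos.2 ⟨a, ha⟩
  obtain ⟨b, hb, hle⟩ : ∃ b ∈ (h.finite_ball a N).toFinset,
      1 / (K : ℝ) ≤ visualWeight e N x (a, b) := by
    -- Unit mass is spread over at most K points.
    refine Finset.exists_le_of_sum_le ⟨a, ha⟩ ?_
    rw [h.sum_visualWeight hx, Finset.sum_const, nsmul_eq_mul, mul_one_div]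
    exact div_le_one_of_le₀ hcard (by positivity)
  refine ⟨b, by simpa [dist_comm] using hb, ?_⟩
  have hpos : 0 < visualWeight e N x (a, b) :=
    (one_div_pos.2 (hcpos.trans_le hcard)).trans_le hle
  have hbx : b ∈ shadow (3 * e) a x N := by
    by_contra hcon
    exact hpos.ne' (h.visualWeight_eq_zero (q := (a, b)) hx hcon)
  -- An endpoint common to both shadows would give dist x y ≤ dist x y + 7e - 2N, contradicting N ≥
  -- 6e + 1.
  have hby : b ∉ shadow (3 * e) a y N := fun hcon => by
    linarith [hbx.2, hcon.2, dist_triangle_left x y b]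
  rw [h.visualWeight_eq_zero (q := (a, b)) hy hby, sub_zero]
  exact hle.trans (le_abs_self _)

end HyperbolicScale

/-! ### Equivariance of the weights. -/

theorem shadow_smul {G X : Type*} [MetricSpace X] [Group G] [MulAction G X] [IsIsometricSMul G X]
    (g : G) (η : ℝ) (a z : X) (s : ℝ) :
    shadow η (g • a) (g • z) s = (fun w => g • w) '' shadow η a z s := by
  ext w
  constructor
  · rintro ⟨h1, h2⟩
    refine ⟨g⁻¹ • w, ⟨?_, ?_⟩, smul_inv_smul g w⟩
    · rwa [← dist_smul g, smul_inv_smul]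
    · rwa [← dist_smul g, smul_inv_smul, ← dist_smul g a z]
  · rintro ⟨w, ⟨h1, h2⟩, rfl⟩
    exact ⟨by rwa [dist_smul], by rwa [dist_smul, dist_smul]⟩

theorem shadowFlow_smul {G X : Type*} [MetricSpace X] [Group G] [MulAction G X]
    [IsIsometricSMul G X] (g : G) (e : ℝ) (N : ℕ) (φ : X → ℝ) (a : X) (j : ℕ) (z : X) :
    shadowFlow e N φ (g • a) j (g • z) = shadowFlow e N (fun w => φ (g • w)) a j z := by
  induction j generalizing z with
  | zero => rfl
  | succ j ih =>
    simp only [shadowFlow]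
    rw [shadow_smul, setMean_image (MulAction.injective g)]
    congr 1
    exact funext ih

theorem visualWeight_smul {G X : Type*} [MetricSpace X] [Group G] [MulAction G X]
    [IsIsometricSMul G X] (g : G) (e : ℝ) (N : ℕ) (x : X) (q : X × X) :
    visualWeight e N (g • x) (g • q) = visualWeight e N x q := by
  simp only [visualWeight, Prod.smul_fst, Prod.smul_snd, dist_smul, shadowFlow_smul]
  have : (fun w => Set.indicator {g • q.2} (1 : X → ℝ) (g • w)) = Set.indicator {q.2} 1 := by
    funext w
    by_cases hw : w = q.2
    · simp [hw]
    · rw [Set.indicator_of_notMem (by simpa using hw), Set.indicator_of_notMem (by simpa using hw)]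
  rw [this]

/-! ### Affine actions on ℓ^p from equivariant families. -/

section Lp

variable {G ι X : Type*} [Group G] [MulAction G ι] {p : ℝ≥0∞} [Fact (1 ≤ p)]

theorem toReal_pos_of_one_le (hp : p ≠ ∞) : 0 < p.toReal :=
  ENNReal.toReal_pos (zero_lt_one.trans_le Fact.out).ne' hp

omit [Fact (1 ≤ p)] in
theorem Memℓp.comp_smul (hp : 0 < p.toReal) {ξ : ι → ℝ} (hξ : Memℓp ξ p) (g : G) :
    Memℓp (fun i => ξ (g • i)) p := by
  have hs : Summable ((fun i => ‖ξ i‖ ^ p.toReal) ∘ MulAction.toPerm g) :=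
    (MulAction.toPerm g).summable_iff.2 (hξ.summable hp)
  exact memℓp_gen hs

/-- The representation of `G` on `ℓ^p(ι)` by permutation of the coordinates. -/
noncomputable def lpPermutation (hp : p ≠ ∞) (g : G) :
    lp (fun _ : ι => ℝ) p ≃ₗᵢ[ℝ] lp (fun _ : ι => ℝ) p where
  toFun ξ := ⟨fun i => ξ (g⁻¹ • i), (lp.memℓp ξ).comp_smul (toReal_pos_of_one_le hp) g⁻¹⟩
  invFun ξ := ⟨fun i => ξ (g • i), (lp.memℓp ξ).comp_smul (toReal_pos_of_one_le hp) g⟩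
  left_inv ξ := by
    refine lp.ext (funext fun i => ?_)
    change ξ (g⁻¹ • g • i) = ξ i
    rw [inv_smul_smul]
  right_inv ξ := by
    refine lp.ext (funext fun i => ?_)
    change ξ (g • g⁻¹ • i) = ξ i
    rw [smul_inv_smul]
  map_add' _ _ := rfl
  map_smul' _ _ := rfl
  norm_map' ξ := by
    rw [lp.norm_eq_tsum_rpow (toReal_pos_of_one_le hp), lp.norm_eq_tsum_rpow
      (toReal_pos_of_one_le hp)]
    congr 1
    exact (MulAction.toPerm g⁻¹).tsum_eq (fun i => ‖ξ i‖ ^ p.toReal)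

theorem lpPermutation_apply (hp : p ≠ ∞) (g : G) (ξ : lp (fun _ : ι => ℝ) p) (i : ι) :
    lpPermutation hp g ξ i = ξ (g⁻¹ • i) :=
  rfl

theorem lpPermutation_single [DecidableEq ι] (hp : p ≠ ∞) (g : G) (i : ι) (t : ℝ) :
    lpPermutation hp g (lp.single (E := fun _ : ι => ℝ) p i t) = lp.single p (g • i) t := by
  refine lp.ext (funext fun j => ?_)
  rw [lpPermutation_apply]
  by_cases h : j = g • i
  · subst h
    rw [inv_smul_smul, lp.single_apply_self, lp.single_apply_self]
  · rw [lp.single_apply_ne _ _ _ h, lp.single_apply_ne]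
    rwa [Ne, inv_smul_eq_iff]

/-- Finitely supported vectors have locally constant orbit maps; since the representation is
isometric, approximating ξ by them is uniform in g. -/
theorem continuous_lpPermutation [TopologicalSpace G] (hp : p ≠ ∞)
    (hι : ∀ i : ι, IsLocallyConstant fun g : G => g • i) (ξ : lp (fun _ : ι => ℝ) p) :
    Continuous fun g : G => lpPermutation hp g ξ := by
  classical
  refine continuous_of_uniform_approx_of_continuous fun u hu => ?_
  obtain ⟨ε, hε, hεu⟩ := Metric.mem_uniformity_dist.1 hu
  obtain ⟨S, hS⟩ := ((Metric.tendsto_nhds.1 (lp.hasSum_single hp ξ)) ε hε).exists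
  refine ⟨fun g => lpPermutation hp g (∑ i ∈ S, lp.single p i (ξ i)), ?_, fun g => hεu ?_⟩
  · simp only [map_sum, lpPermutation_single]
    exact continuous_finsetSum _ fun i _ =>
      ((hι i).comp fun j => lp.single (E := fun _ : ι => ℝ) p j (ξ i)).continuous
  · rw [LinearIsometryEquiv.dist_map, dist_comm]
    exact hS

variable [MulAction G X]

/-- A `G`-equivariant family `f` of functions on `ι` whose differences are in `ℓ^p` induces an
affine isometric action with linear part the permutation representation and cocycle
`g ↦ f (g • o) - f o`. -/
noncomputable def lpAffineAction [TopologicalSpace G] (hp : p ≠ ∞)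
    (hι : ∀ i : ι, IsLocallyConstant fun g : G => g • i) (f : X → ι → ℝ)
    (hf : ∀ (g : G) x i, f (g • x) (g • i) = f x i)
    (hmem : ∀ x y, Memℓp (f x - f y) p) (o : X) (ho : IsLocallyConstant fun g : G => g • o) :
    AffineIsometricAction G (lp (fun _ : ι => ℝ) p) (lp (fun _ : ι => ℝ) p) where
  toHom := MonoidHom.mk'
    (fun g => AffineIsometryEquiv.mk'
      (fun ξ => lpPermutation hp g ξ + ⟨f (g • o) - f o, hmem _ _⟩) (lpPermutation hp g) 0
      (fun ξ => by simp)) (by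
    intro g h
    ext1 ξ
    rw [AffineIsometryEquiv.coe_mul, Function.comp_apply]
    simp only [AffineIsometryEquiv.coe_mk']
    refine lp.ext (funext fun i => ?_)
    change ξ ((g * h)⁻¹ • i) + (f ((g * h) • o) i - f o i) =
      (ξ (h⁻¹ • g⁻¹ • i) + (f (h • o) (g⁻¹ • i) - f o (g⁻¹ • i))) + (f (g • o) i - f o i)
    have h1 := hf g (h • o) (g⁻¹ • i)
    have h2 := hf g o (g⁻¹ • i)
    rw [smul_inv_smul] at h1 h2
    rw [← h1, ← h2, mul_inv_rev, mul_smul, mul_smul]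
    ring)
  continuous_orbit ξ := by
    refine (continuous_lpPermutation hp hι ξ).add ?_
    exact (ho.comp fun x => (⟨f x - f o, hmem _ _⟩ : lp (fun _ : ι => ℝ) p)).continuous

/-- Moving the origin to ξ changes the cocycle by π(g)ξ - ξ, of norm at most 2‖ξ‖. -/
theorem lpAffineAction_isProper [TopologicalSpace G] (hp : p ≠ ∞)
    (hι : ∀ i : ι, IsLocallyConstant fun g : G => g • i) (f : X → ι → ℝ)
    (hf : ∀ (g : G) x i, f (g • x) (g • i) = f x i)
    (hmem : ∀ x y, Memℓp (f x - f y) p) (o : X) (ho : IsLocallyConstant fun g : G => g • o)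
    (hprop : Tendsto
      (fun g : G => ‖(⟨f (g • o) - f o, hmem _ _⟩ : lp (fun _ : ι => ℝ) p)‖) (cocompact G) atTop) :
    (lpAffineAction hp hι f hf hmem o ho).IsProper := by
  intro ξ
  refine tendsto_atTop_mono (fun g => ?_) (tendsto_atTop_add_const_right _ (-(2 * ‖ξ‖)) hprop)
  set c : lp (fun _ : ι => ℝ) p := ⟨f (g • o) - f o, hmem _ _⟩
  change ‖c‖ + -(2 * ‖ξ‖) ≤ ‖(lpPermutation hp g ξ + c) - ξ‖
  have h1 := norm_sub_le ((lpPermutation hp g ξ + c) - ξ) (lpPermutation hp g ξ - ξ)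
  have h2 := norm_sub_le (lpPermutation hp g ξ) ξ
  rw [LinearIsometryEquiv.norm_map] at h2
  rw [show (lpPermutation hp g ξ + c) - ξ - (lpPermutation hp g ξ - ξ) = c by abel] at h1
  linarith

end Lp

/-! ### Growth of balls and bounds on the ℓ^p norm. -/

theorem summable_of_sum_fiber_le {ι : Type*} {f : ι → ℝ} (hf : 0 ≤ f) (n : ι → ℕ) {B : ℕ → ℝ}
    (hB : Summable B) (h : ∀ k (S : Finset ι), (∀ i ∈ S, n i = k) → ∑ i ∈ S, f i ≤ B k) :
    Summable f := by
  classical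
  have hB0 : ∀ k, 0 ≤ B k := fun k => by simpa using h k ∅ (by simp)
  refine summable_of_sum_le (c := ∑' k, B k) hf fun S => ?_
  rw [← Finset.sum_fiberwise_of_maps_to (t := S.image n) (g := n)
    (fun i hi => Finset.mem_image_of_mem n hi)]
  exact (Finset.sum_le_sum fun k _ => h k _ fun i hi => (Finset.mem_filter.1 hi).2).trans
    (hB.sum_le_tsum _ fun k _ => hB0 k)

namespace HyperbolicScale

variable {X : Type*} [MetricSpace X] {e : ℝ} {N : ℕ}

/-- Balls grow at most exponentially. -/
theorem card_le_pow (h : HyperbolicScale X e N) {K : ℕ}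
    (hK : ∀ x : X, (Metric.closedBall x (2 * N)).ncard ≤ K) (x : X) (n : ℕ) :
    (h.finite_ball x (n * N)).toFinset.card ≤ K ^ n := by
  classical
  have hN := h.scale_pos
  have hNe := h.le_scale
  have he := h.nonneg
  induction n with
  | zero => simp
  | succ n ih =>
    have hsub : (h.finite_ball x ((n + 1 : ℕ) * N)).toFinset ⊆
        (h.finite_ball x (n * N)).toFinset.biUnion
          fun z => (h.finite_ball z (2 * N)).toFinset := by
      intro y hy
      simp only [Set.Finite.mem_toFinset, Metric.mem_closedBall, Nat.cast_add, Nat.cast_one,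
        Finset.mem_biUnion] at hy ⊢
      rw [dist_comm] at hy
      rcases le_total (n * N : ℝ) (dist x y) with hle | hle
      -- Here dist z y ≤ N + e ≤ 2N.
      · obtain ⟨z, hz1, hz2⟩ := h.geodesic x y (n * N) (by positivity) hle
        exact ⟨z, by rwa [dist_comm], by rw [dist_comm]; nlinarith⟩
      · exact ⟨y, by rwa [dist_comm], by rw [dist_self]; positivity⟩
    refine (Finset.card_le_card hsub).trans ?_
    rw [pow_succ]
    refine (Finset.card_biUnion_le_card_mul _ _ K fun z _ => ?_).trans
      (Nat.mul_le_mul_right _ ih)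
    rw [← Set.ncard_eq_toFinset_card _ (h.finite_ball z (2 * N))]
    exact hK z

/-- The first coordinate lies in a ball of radius (n + 1)N, and each one admits at most K second
coordinates. -/
theorem card_pairs_le (h : HyperbolicScale X e N) {K : ℕ}
    (hK : ∀ x : X, (Metric.closedBall x (2 * N)).ncard ≤ K) (x : X) (n : ℕ)
    (S : Finset (pairsWithin X N)) (hS : ∀ q ∈ S, ⌊dist q.1.1 x / N⌋₊ = n) :
    S.card ≤ K * K ^ (n + 1) := by
  classical
  have hN := h.scale_pos
  refine (Finset.card_le_mul_card_image (f := fun q : pairsWithin X N => q.1.1) S K ?_).trans ?_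
  · intro a _
    refine le_trans ?_ (hK a)
    rw [Set.ncard_eq_toFinset_card _ (h.finite_ball a (2 * N))]
    refine Finset.card_le_card_of_injOn (fun q => q.1.2) ?_ ?_
    · intro q hq
      have hq' := (Finset.mem_filter.1 hq).2
      have h2 : dist q.1.1 q.1.2 ≤ N := q.2
      simp only [Set.Finite.coe_toFinset, Metric.mem_closedBall]
      rw [dist_comm, ← hq']
      linarith
    · intro q hq r hr hqr
      have hq' := (Finset.mem_filter.1 hq).2
      have hr' := (Finset.mem_filter.1 hr).2
      exact Subtype.ext (Prod.ext (hq'.trans hr'.symm) hqr)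
  · refine Nat.mul_le_mul_left _ (le_trans (Finset.card_le_card ?_) (h.card_le_pow hK x (n + 1)))
    intro a ha
    obtain ⟨q, hq, rfl⟩ := Finset.mem_image.1 ha
    have := Nat.lt_floor_add_one (dist q.1.1 x / N)
    rw [hS q hq, div_lt_iff₀ hN] at this
    simp only [Set.Finite.mem_toFinset, Metric.mem_closedBall]
    push_cast
    exact this.le

/-- Shell n has at most K^(n+2) pairs, each contributing at most a constant times l^(pn). -/
theorem memℓp_visualWeight_sub (h : HyperbolicScale X e N) {K : ℕ}
    (hK : ∀ x : X, (Metric.closedBall x (2 * N)).ncard ≤ K) {l : ℝ} (hl : 0 < l) (hl1 : l ≤ 1)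
    (hKl : 1 - 1 / ((K * K : ℕ) : ℝ) ≤ l) {p : ℝ≥0∞} (hp : K * l ^ p.toReal < 1) (x y : X) :
    Memℓp ((fun q : pairsWithin X N => visualWeight e N x q) -
      fun q : pairsWithin X N => visualWeight e N y q) p := by
  have hN := h.scale_pos
  have he := h.nonneg
  have hNe := h.le_scale
  have hK' : ∀ x : X, (Metric.closedBall x (5 * e)).ncard ≤ K := fun z =>
    (Set.ncard_le_ncard (Metric.closedBall_subset_closedBall (by linarith))
      (h.finite_ball z _)).trans (hK z)
  obtain ⟨m, hm⟩ := exists_nat_ge (dist x y / N)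
  rw [div_le_iff₀ hN] at hm
  set P := p.toReal with hP
  have hP0 : 0 ≤ P := ENNReal.toReal_nonneg
  -- This constant absorbs the truncated exponent n - (m + 1), also when n ≤ m.
  set C : ℝ := (l ^ (m + 1))⁻¹ with hC
  have hC0 : 0 ≤ C := by positivity
  refine memℓp_gen ?_
  have hbound : ∀ q : X × X, ‖visualWeight e N x q - visualWeight e N y q‖ ^ P ≤
      C ^ P * (l ^ P) ^ ⌊dist q.1 x / N⌋₊ := by
    intro q
    set n := ⌊dist q.1 x / N⌋₊
    have h1 : |visualWeight e N x q - visualWeight e N y q| ≤ C * l ^ n := by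
      refine (h.abs_visualWeight_sub_le hK' hl.le hKl hm q).trans ?_
      rw [hC, inv_mul_eq_div, le_div_iff₀ (by positivity), ← pow_add]
      exact pow_le_pow_of_le_one hl.le hl1 (by omega)
    rw [Real.norm_eq_abs]
    refine (Real.rpow_le_rpow (abs_nonneg _) h1 hP0).trans (le_of_eq ?_)
    rw [Real.mul_rpow hC0 (by positivity), ← Real.rpow_natCast, ← Real.rpow_mul hl.le,
      ← Real.rpow_natCast, ← Real.rpow_mul hl.le, mul_comm P]
  refine summable_of_sum_fiber_le (fun _ => Real.rpow_nonneg (norm_nonneg _) _)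
    (fun q : pairsWithin X N => ⌊dist q.1.1 x / N⌋₊)
    (B := fun n => K * K * C ^ P * (K * l ^ P) ^ n)
    ((summable_geometric_of_lt_one (by positivity) hp).mul_left _) fun n S hS => ?_
  calc _ ≤ ∑ q ∈ S, C ^ P * (l ^ P) ^ n := Finset.sum_le_sum fun q hq => by
        have := hbound q.1
        rw [hS q hq] at this
        exact this
    _ = S.card * (C ^ P * (l ^ P) ^ n) := by rw [Finset.sum_const, nsmul_eq_mul]
    _ ≤ (K * K ^ (n + 1) : ℕ) * (C ^ P * (l ^ P) ^ n) := by
        have := h.card_pairs_le hK x n S hS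
        gcongr
    _ = _ := by
        push_cast
        ring

/-- The `p`-th power of the norm of `f x - f y` grows at least linearly in `dist x y`. -/
theorem le_norm_rpow (h : HyperbolicScale X e N) {K : ℕ}
    (hK : ∀ x : X, (Metric.closedBall x N).ncard ≤ K) {p : ℝ≥0∞} (hp : 0 < p.toReal)
    (x y : X) (ξ : lp (fun _ : pairsWithin X N => ℝ) p)
    (hξ : ∀ q : pairsWithin X N, ξ q = visualWeight e N x q - visualWeight e N y q) {k : ℕ}
    (hk : (k + 3 : ℝ) * N ≤ dist x y) :
    k * (1 / (K : ℝ)) ^ p.toReal ≤ ‖ξ‖ ^ p.toReal := by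
  classical
  have hN := h.scale_pos
  have he := h.nonneg
  have hNe := h.le_scale
  -- Level i + 2 keeps a at distance at least N from x despite the loss e; the 3 in `hk` leaves room
  -- near y. As e < N, different i give different pairs.
  have hex : ∀ i : Fin k, ∃ q : pairsWithin X N,
      ((i + 2 : ℝ) * N - e ≤ dist x q.1.1 ∧ dist x q.1.1 ≤ (i + 2 : ℝ) * N) ∧
        1 / (K : ℝ) ≤ |ξ q| := by
    intro i
    have hi : (i : ℝ) + 1 ≤ k := by exact_mod_cast i.2
    have hi0 : (0 : ℝ) ≤ i := by positivity
    have hle : (i + 2 : ℝ) * N + 2 * N ≤ dist x y := by nlinarith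
    obtain ⟨a, ha1, ha2⟩ := h.geodesic x y ((i + 2 : ℝ) * N) (by positivity) (by linarith)
    have htri := dist_triangle x a y
    obtain ⟨b, hb, hab⟩ := h.exists_le_abs_visualWeight_sub hK (a := a) (x := x) (y := y)
      (by rw [dist_comm]; nlinarith) (by linarith) (by rw [dist_comm a x]; linarith)
    exact ⟨⟨(a, b), hb⟩, ⟨by linarith, ha1⟩, by rwa [hξ]⟩
  choose q hq1 hq2 using hex
  have hinj : Function.Injective q := by
    have hlt : ∀ i j : Fin k, q i = q j → ¬ i < j := by
      intro i j hij hlt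
      have : (i : ℝ) + 1 ≤ j := by exact_mod_cast hlt
      have h1 := (hq1 i).2
      have h2 := (hq1 j).1
      rw [hij] at h1
      nlinarith
    intro i j hij
    rcases lt_trichotomy i j with hlt' | heq | hlt'
    · exact absurd hlt' (hlt i j hij)
    · exact heq
    · exact absurd hlt' (hlt j i hij.symm)
  refine le_trans ?_ (lp.sum_rpow_le_norm_rpow hp ξ (Finset.univ.image q))
  rw [Finset.sum_image fun i _ j _ hij => hinj hij]
  calc k * (1 / (K : ℝ)) ^ p.toReal = ∑ _i : Fin k, (1 / (K : ℝ)) ^ p.toReal := by simp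
    _ ≤ _ := Finset.sum_le_sum fun i _ =>
        Real.rpow_le_rpow (by positivity) (hq2 i) hp.le

end HyperbolicScale

/-! ### Consequences of local finiteness and conclusion. -/

theorem IsUniformlyLocallyFinite.finite_closedBall {X : Type*} [MetricSpace X]
    (hfin : IsUniformlyLocallyFinite X) (x : X) (r : ℝ) : (Metric.closedBall x r).Finite := by
  obtain ⟨K, hK⟩ := hfin (max r 0) (le_max_right _ _)
  exact (Set.finite_of_encard_le_coe (hK x)).subset
    (Metric.closedBall_subset_closedBall (le_max_left _ _))

theorem IsUniformlyLocallyFinite.exists_ncard_le {X : Type*} [MetricSpace X]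
    (hfin : IsUniformlyLocallyFinite X) {r : ℝ} (hr : 0 ≤ r) :
    ∃ K : ℕ, ∀ x : X, (Metric.closedBall x r).ncard ≤ K := by
  obtain ⟨K, hK⟩ := hfin r hr
  refine ⟨K, fun x => ?_⟩
  have := hK x
  rw [← (hfin.finite_closedBall x r).cast_ncard_eq] at this
  exact_mod_cast this

/-- Discreteness makes the orbit maps of G on points and pairs locally constant, which gives
continuity of the affine action. -/
theorem IsUniformlyLocallyFinite.discreteTopology {X : Type*} [MetricSpace X]
    (hfin : IsUniformlyLocallyFinite X) : DiscreteTopology X := by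
  refine discreteTopology_iff_isOpen_singleton.2 fun x => ?_
  exact isOpen_singleton_of_finite_mem_nhds x (Metric.closedBall_mem_nhds x one_pos)
    (hfin.finite_closedBall x 1)

theorem exists_hyperbolicScale {X : Type*} [MetricSpace X] (hhyp : IsHyperbolicSpace X)
    (hgeod : IsWeaklyGeodesic X) (hfin : IsUniformlyLocallyFinite X) :
    ∃ (e : ℝ) (N : ℕ), HyperbolicScale X e N := by
  obtain ⟨δ, hδ, h4⟩ := hhyp
  obtain ⟨δ', hδ', hg⟩ := hgeod
  obtain ⟨N, hN⟩ := exists_nat_ge (6 * (δ + δ') + 1)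
  refine ⟨δ + δ', N, by positivity, fun x₁ x₂ x₃ x₄ => ?_, fun x y s hs hsx => ?_, hN,
    hfin.finite_closedBall⟩
  · linarith [h4 x₁ x₂ x₃ x₄]
  · obtain ⟨z, hz1, hz2⟩ := hg x y s ⟨hs, by linarith⟩
    exact ⟨z, hz1, by linarith⟩

/-- The diagonal action of `G` on the pairs of points at distance at most `R`. -/
instance pairsWithin.instMulAction {G X : Type*} [MetricSpace X] [Group G] [MulAction G X]
    [IsIsometricSMul G X] (R : ℕ) : MulAction G (pairsWithin X R) where
  smul g q := ⟨g • q.1, (dist_smul g q.1.1 q.1.2).trans_le q.2⟩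
  one_smul q := Subtype.ext (one_smul G q.1)
  mul_smul g h q := Subtype.ext (mul_smul g h q.1)

theorem mainTheorem4 {X G : Type*} [MetricSpace X] [Nonempty X]
    [Group G] [TopologicalSpace G] [IsTopologicalGroup G]
    [MulAction G X] [IsIsometricSMul G X] [ContinuousSMul G X]
    (hhyp : IsHyperbolicSpace X) (hgeod : IsWeaklyGeodesic X)
    (hfin : IsUniformlyLocallyFinite X) (hproper : IsMetricallyProperAction G X) :
    ∃ R : ℕ, ∃ p₀ : ℝ≥0, ∀ (p : ℝ≥0∞) [Fact (1 ≤ p)], (p₀ : ℝ≥0∞) ≤ p → p ≠ ∞ →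
      ∃ α : AffineIsometricAction G
          (lp (fun _ : pairsWithin X R => ℝ) p) (lp (fun _ : pairsWithin X R => ℝ) p),
        α.IsProper := by
  obtain ⟨e, N, h⟩ := exists_hyperbolicScale hhyp hgeod hfin
  have hN := h.scale_pos
  have := hfin.discreteTopology
  obtain ⟨K₀, hK₀⟩ := hfin.exists_ncard_le (r := 2 * N) (by positivity)
  -- Adding 2 forces K ≥ 2, so that 0 < l < 1.
  set K : ℕ := K₀ + 2 with hKdef
  have hK : ∀ x : X, (Metric.closedBall x (2 * N)).ncard ≤ K := fun x => (hK₀ x).trans (by omega)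
  have hKN : ∀ x : X, (Metric.closedBall x N).ncard ≤ K := fun x =>
    (Set.ncard_le_ncard (Metric.closedBall_subset_closedBall (by linarith))
      (h.finite_ball x _)).trans (hK x)
  have hK2 : (2 : ℝ) ≤ K := by rw [hKdef]; push_cast; linarith [K₀.cast_nonneg (α := ℝ)]
  have hKK : (1 : ℝ) < (K * K : ℕ) := by push_cast; nlinarith
  set l : ℝ := 1 - 1 / ((K * K : ℕ) : ℝ) with hldef
  have hl : 0 < l := by
    rw [hldef, sub_pos, div_lt_one (by linarith)]
    exact hKK
  have hl1 : l < 1 := by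
    rw [hldef, sub_lt_self_iff]
    exact one_div_pos.2 (by linarith)
  -- This n serves as p₀: K l^p < 1 for all p ≥ n.
  obtain ⟨n, hn⟩ := exists_pow_lt_of_lt_one (show (0 : ℝ) < 1 / K by positivity) hl1
  refine ⟨N, n, fun p _ hnp hp => ?_⟩
  have hp0 : 0 < p.toReal := toReal_pos_of_one_le hp
  have hpn : (n : ℝ) ≤ p.toReal := by
    have := ENNReal.toReal_mono hp hnp
    simpa using this
  have hKl : K * l ^ p.toReal < 1 := by
    have h1 := Real.rpow_le_rpow_of_exponent_ge hl hl1.le hpn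
    rw [Real.rpow_natCast] at h1
    rw [lt_div_iff₀' (by linarith)] at hn
    exact (mul_le_mul_of_nonneg_left h1 (by linarith)).trans_lt hn
  have hsmul : ∀ x : X, IsLocallyConstant fun g : G => g • x := fun x =>
    (IsLocallyConstant.iff_continuous _).2 (continuous_id.smul continuous_const)
  have hpairs : ∀ q : pairsWithin X N, IsLocallyConstant fun g : G => g • q := fun q =>
    (IsLocallyConstant.iff_continuous _).2
      (Continuous.subtype_mk (continuous_id.smul continuous_const) _)
  obtain ⟨o⟩ := ‹Nonempty X›
  obtain ⟨f, hf⟩ : ∃ f : X → pairsWithin X N → ℝ, ∀ x q, f x q = visualWeight e N x q.1 :=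
    ⟨_, fun _ _ => rfl⟩
  have hmem : ∀ x y, Memℓp (f x - f y) p := fun x y => by
    rw [funext (hf x), funext (hf y)]
    exact h.memℓp_visualWeight_sub hK hl hl1.le le_rfl hKl x y
  have hequiv : ∀ (g : G) x q, f (g • x) (g • q) = f x q := fun g x q => by
    rw [hf, hf]
    exact visualWeight_smul g e N x q.1
  refine ⟨lpAffineAction hp hpairs f hequiv hmem o (hsmul o),
    lpAffineAction_isProper hp hpairs f hequiv hmem o (hsmul o) ?_⟩
  rw [tendsto_atTop]
  intro B
  -- With this k the linear lower bound already exceeds |B|^p.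
  obtain ⟨k, hk⟩ := exists_nat_ge (|B| ^ p.toReal / (1 / (K : ℝ)) ^ p.toReal)
  filter_upwards [(hproper o).eventually_ge_atTop ((k + 3 : ℝ) * N)] with g hg
  have hlow := h.le_norm_rpow hKN hp0 (g • o) o
    ⟨_, hmem (g • o) o⟩ (fun q => congrArg₂ (· - ·) (hf _ q) (hf _ q)) (by rwa [dist_comm])
  rw [div_le_iff₀ (by positivity)] at hk
  exact (le_abs_self B).trans
    ((Real.rpow_le_rpow_iff (abs_nonneg B) (norm_nonneg _) hp0).1 (hk.trans hlow))
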